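/- All Riesz spaces (vector lattices) are real. A Riesz space $X$ is Archimedean if $nx\le y$ for all $n\in\mathbb N$ implies $x\le 0$. A net $(x_\alpha)_{\alpha\in A}$ in $X$ converges in order to $x\in X$, written $x_\alpha\xrightarrow{o}x$, if there is a net $(b_\gamma)_{\gamma\in\Lambda}$ in $X$, over a possibly different directed set $\Lambda$, with $b_\gamma\downarrow 0$, such that for every $\gamma\in\Lambda$ there is $\alpha_0\in A$ with $|x_\alpha-x|\le b_\gamma$ for all $\alpha\ge\alpha_0$. A linear operator $T:E\to F$ between Riesz spaces is order bounded if it maps order bounded sets to order bounded sets; $\mathcal L^b(E,F)$ denotes the space of all such operators. $T$ is order continuous if $x_\alpha\xrightarrow{o}0$ implies $T(x_\alpha)\xrightarrow{o}0$ for every net $(x_\alpha)$ in $E$, and $\sigma$-order continuous if $x_n\xrightarrow{o}0$ implies $T(x_n)\xrightarrow{o}0$ for every sequence $(x_n)$ in $E$. An atom of $E$ is an element $e\ge 0$ such that $0\le x\le e$ implies that $x$ is a scalar multiple of $e$. A complete disjoint system of atoms in $E$ is a set of atoms $e_i>0$ $(i\in I)$ with $e_i\wedge e_j=0$ for $i\ne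 j$, such that $x\wedge e_i=0$ for all $i\in I$ implies $x=0$. **Theorem 4.1.** Let $E$ and $F$ be Archimedean Riesz spaces, where $E$ has a countable complete disjoint system of atoms, and let $T\in\mathcal L^b(E,F)$. Then $T$ is order continuous if and only if $T$ is $\sigma$-order continuous. Furthermore, if $E=c$ (the space of convergent real sequences) or $E=\ell_0^\infty$ (the space of eventually constant real sequences), each with the coordinatewise operations and order, then $T$ is order continuous if and only if $\sum_{i=1}^n T(\mathbf e_i)\xrightarrow{o}T(\mathbf 1)$ as $n\to\infty$, where $\mathbf e_i$ is the sequence whose $i$-th term is $1$ and whose other terms are $0$, and $\mathbf 1$ is the constant sequence with all terms equal to $1$. -/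

import Mathlib

open Filter Topology

universe u v w

namespace RieszOC

/-! A Riesz space (real vector lattice) is a type `X` carrying the instances `AddCommGroup X`,
`Lattice X`, `IsOrderedAddMonoid X`, `Module ℝ X` and `IsOrderedModule ℝ X`. -/

/-- The Archimedean property of an ordered vector space: if `n x ≤ y` for all `n`, then `x ≤ 0`.
(Mathlib's class `Archimedean` is a different, much stronger condition when the order is not
total.) -/
def IsArchimedean (X : Type u) [AddCommGroup X] [Lattice X] : Prop :=
  ∀ x y : X, (∀ n : ℕ, n • x ≤ y) → x ≤ 0

/-- A net `(b_γ)` decreases to `0`: it is antitone and its infimum is `0`. -/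
def DecreasesToZero {X : Type u} [AddCommGroup X] [Lattice X] {Λ : Type w} [Preorder Λ]
    (b : Λ → X) : Prop :=
  Antitone b ∧ IsGLB (Set.range b) 0

/-- Order convergence `x_α → a` of a net: there is a net `b_γ ↓ 0`, over a possibly different
directed set `Λ`, such that for every `γ` one has `|x_α - a| ≤ b_γ` for all large `α`.
Taking `Λ` in the universe of `X` is no restriction, since a net decreasing to `0` can be
reindexed by its range with the reversed order. -/
def OrderTendsto {X : Type u} [AddCommGroup X] [Lattice X] {A : Type w} [Preorder A]
    (x : A → X) (a : X) : Prop :=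
  ∃ (Λ : Type u) (_ : Preorder Λ) (_ : IsDirectedOrder Λ) (_ : Nonempty Λ) (b : Λ → X),
    DecreasesToZero b ∧ ∀ γ : Λ, ∃ α₀ : A, ∀ α : A, α₀ ≤ α → |x α - a| ≤ b γ

section Operators

variable {E : Type u} {F : Type v}
  [AddCommGroup E] [Lattice E] [Module ℝ E] [AddCommGroup F] [Lattice F] [Module ℝ F]

/-- `T` is order bounded: it maps order bounded sets to order bounded sets. -/
def IsOrderBounded (T : E →ₗ[ℝ] F) : Prop :=
  ∀ s : Set E, BddBelow s → BddAbove s → BddBelow (T '' s) ∧ BddAbove (T '' s)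

/-- `T` is order continuous: it maps nets order converging to `0` to nets order converging
to `0`. The universe `w` of the index sets of the nets is arbitrary. -/
def IsOrderContinuous (T : E →ₗ[ℝ] F) : Prop :=
  ∀ (A : Type w) [Preorder A] [IsDirectedOrder A] [Nonempty A] (x : A → E),
    OrderTendsto x 0 → OrderTendsto (fun α => T (x α)) 0

/-- `T` is `σ`-order continuous: it maps sequences order converging to `0` to sequences order
converging to `0`. -/
def IsSigmaOrderContinuous (T : E →ₗ[ℝ] F) : Prop :=
  ∀ x : ℕ → E, OrderTendsto x 0 → OrderTendsto (fun n => T (x n)) 0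

end Operators

/-- `e` is an atom: `e ≥ 0`, and `0 ≤ x ≤ e` implies that `x` is a scalar multiple of `e`. -/
def IsRieszAtom {X : Type u} [AddCommGroup X] [Lattice X] [Module ℝ X] (e : X) : Prop :=
  0 ≤ e ∧ ∀ x : X, 0 ≤ x → x ≤ e → ∃ r : ℝ, x = r • e

/-- Complete disjoint systems: strictly positive, pairwise disjoint elements such that only `0` is
disjoint from all of them. -/
def IsCompleteDisjointSystem {X : Type u} [AddCommGroup X] [Lattice X] (S : Set X) : Prop :=
  (∀ e ∈ S, 0 < e) ∧ (∀ e ∈ S, ∀ e' ∈ S, e ≠ e' → e ⊓ e' = 0) ∧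
    ∀ x : X, (∀ e ∈ S, x ⊓ e = 0) → x = 0

/-- `X` has a countable (finite or infinite) complete disjoint system of atoms. -/
def HasCountableAtomSystem (X : Type u) [AddCommGroup X] [Lattice X] [Module ℝ X] : Prop :=
  ∃ S : Set X, S.Countable ∧ IsCompleteDisjointSystem S ∧ ∀ e ∈ S, IsRieszAtom e

/-- The space `c` of convergent real sequences. -/
def ConvSeq : Submodule ℝ (ℕ → ℝ) where
  carrier := {x | ∃ a : ℝ, Tendsto x atTop (𝓝 a)}
  zero_mem' := ⟨0, tendsto_const_nhds⟩
  add_mem' := fun ⟨a, ha⟩ ⟨b, hb⟩ => ⟨a + b, ha.add hb⟩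
  smul_mem' := fun r _ ⟨a, ha⟩ => ⟨r * a, ha.const_mul r⟩

/-- The space `ℓ₀^∞` of eventually constant real sequences. -/
def EvConstSeq : Submodule ℝ (ℕ → ℝ) where
  carrier := {x | ∃ a : ℝ, ∀ᶠ n in atTop, x n = a}
  zero_mem' := ⟨0, Eventually.of_forall fun _ => rfl⟩
  add_mem' := fun ⟨a, ha⟩ ⟨b, hb⟩ => ⟨a + b, by
    filter_upwards [ha, hb] with n h h'
    simp [h, h']⟩
  smul_mem' := fun r _ ⟨a, ha⟩ => ⟨r * a, by
    filter_upwards [ha] with n h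
    simp [h]⟩

/-- The coordinatewise lattice structure on a subspace of `ℝ^ℕ` that is closed under coordinatewise
suprema and infima. -/
abbrev subspaceLattice (p : Submodule ℝ (ℕ → ℝ)) (hsup : ∀ x ∈ p, ∀ y ∈ p, x ⊔ y ∈ p)
    (hinf : ∀ x ∈ p, ∀ y ∈ p, x ⊓ y ∈ p) : Lattice p where
  __ := (inferInstance : PartialOrder p)
  sup x y := ⟨x.1 ⊔ y.1, hsup _ x.2 _ y.2⟩
  inf x y := ⟨x.1 ⊓ y.1, hinf _ x.2 _ y.2⟩
  le_sup_left x y := (le_sup_left : x.1 ≤ x.1 ⊔ y.1)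
  le_sup_right x y := (le_sup_right : y.1 ≤ x.1 ⊔ y.1)
  sup_le x y z h h' := (sup_le h h' : x.1 ⊔ y.1 ≤ z.1)
  inf_le_left x y := (inf_le_left : x.1 ⊓ y.1 ≤ x.1)
  inf_le_right x y := (inf_le_right : x.1 ⊓ y.1 ≤ y.1)
  le_inf x y z h h' := (le_inf h h' : x.1 ≤ y.1 ⊓ z.1)

instance : Lattice ConvSeq :=
  subspaceLattice ConvSeq
    (fun _ ⟨a, ha⟩ _ ⟨b, hb⟩ => ⟨a ⊔ b, ha.sup_nhds hb⟩)
    (fun _ ⟨a, ha⟩ _ ⟨b, hb⟩ => ⟨a ⊓ b, ha.inf_nhds hb⟩)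

instance : Lattice EvConstSeq :=
  subspaceLattice EvConstSeq
    (fun _ ⟨a, ha⟩ _ ⟨b, hb⟩ => ⟨a ⊔ b, by
      filter_upwards [ha, hb] with n h h'
      simp [h, h']⟩)
    (fun _ ⟨a, ha⟩ _ ⟨b, hb⟩ => ⟨a ⊓ b, by
      filter_upwards [ha, hb] with n h h'
      simp [h, h']⟩)

instance : IsOrderedAddMonoid ConvSeq where
  add_le_add_left _ _ h z := fun n => add_le_add_left (h n) (z.1 n)

instance : IsOrderedAddMonoid EvConstSeq where
  add_le_add_left _ _ h z := fun n => add_le_add_left (h n) (z.1 n)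

instance : IsOrderedModule ℝ ConvSeq where
  smul_le_smul_of_nonneg_left _ hr _ _ h := fun n => mul_le_mul_of_nonneg_left (h n) hr
  smul_le_smul_of_nonneg_right _ hx _ _ h := fun n => mul_le_mul_of_nonneg_right h (hx n)

instance : IsOrderedModule ℝ EvConstSeq where
  smul_le_smul_of_nonneg_left _ hr _ _ h := fun n => mul_le_mul_of_nonneg_left (h n) hr
  smul_le_smul_of_nonneg_right _ hx _ _ h := fun n => mul_le_mul_of_nonneg_right h (hx n)

theorem single_eventually_zero (n : ℕ) : ∀ᶠ m in atTop, (Pi.single n 1 : ℕ → ℝ) m = 0 := by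
  filter_upwards [eventually_gt_atTop n] with m hm
  simp [hm.ne']

/-- The unit sequence in `c` whose only nonzero term is a `1` at place `n`. -/
def ConvSeq.e (n : ℕ) : ConvSeq :=
  ⟨Pi.single n 1, 0, tendsto_const_nhds.congr'
    ((single_eventually_zero n).mono fun _ h => h.symm)⟩

/-- The constant sequence `1` in `c`. -/
def ConvSeq.one : ConvSeq := ⟨fun _ => 1, 1, tendsto_const_nhds⟩

/-- The unit sequence in `ℓ₀^∞` whose only nonzero term is a `1` at place `n`. -/
def EvConstSeq.e (n : ℕ) : EvConstSeq := ⟨Pi.single n 1, 0, single_eventually_zero n⟩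

/-- The constant sequence `1` in `ℓ₀^∞`. -/
def EvConstSeq.one : EvConstSeq := ⟨fun _ => 1, 1, Eventually.of_forall fun _ => rfl⟩

end RieszOC

set_option linter.unusedSectionVars false

/-! `F` need not be Dedekind complete, so `T⁺` may not exist; upper bounds of `T [0, b γ]` replace
`T⁺ (b γ)`, and `NullAlong` says that they have no positive lower bound. If this holds for `T` and
`-T` along a net dominating `x`, then `T x` tends to `0` (`orderTendsto_of_nullAlong`). For a
decreasing sequence it follows from order convergence of `T (y ⊓ b n)` to `0` and the Archimedean
property (`nullAlong_of_sequence`). Countably many atoms allow a sequence decreasing to `0` to be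
drawn from any net doing so, which reduces nets to sequences. In `c` and `ℓ₀^∞` the only sequence
needed is that of the tails of `one`: a net decreasing to `0` is eventually small on any finite set
of coordinates, and the rest lies under a multiple of a tail. -/

namespace RieszOC

/-! ### Order convergence and the Archimedean property. -/

section Convergence

variable {X : Type u} [AddCommGroup X] [Lattice X] [IsOrderedAddMonoid X]

/-- A net converges in order exactly when the infimum of the eventual bounds of its distance to the
limit is `0`. -/
theorem orderTendsto_iff {A : Type w} [Preorder A] [IsDirectedOrder A] [Nonempty A]
    {x : A → X} {a : X} :
    OrderTendsto x a ↔
      ∀ w : X, (∀ u : X, (∃ α₀ : A, ∀ α, α₀ ≤ α → |x α - a| ≤ u) → w ≤ u) → w ≤ 0 := by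
  constructor
  · rintro ⟨Λ, _, _, _, b, hb, h⟩ w hw
    refine hb.2.2 ?_
    rintro _ ⟨γ, rfl⟩
    exact hw _ (h γ)
  · intro h
    let U : Set X := {u | ∃ α₀ : A, ∀ α, α₀ ≤ α → |x α - a| ≤ u}
    have hU : ∀ u ∈ U, 0 ≤ u := fun u ⟨α₀, hu⟩ => (abs_nonneg _).trans (hu α₀ le_rfl)
    have hinf : ∀ u ∈ U, ∀ v ∈ U, u ⊓ v ∈ U := by
      rintro u ⟨α, hα⟩ v ⟨β, hβ⟩
      obtain ⟨δ, h1, h2⟩ := exists_ge_ge α β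
      exact ⟨δ, fun i hi => le_inf (hα i (h1.trans hi)) (hβ i (h2.trans hi))⟩
    -- If `U` were empty, `h` would make every element `≤ 0`, and `0` would then be an eventual
    -- bound.
    have hne : U.Nonempty := by
      by_contra hne
      have h0 : ∀ w : X, w ≤ 0 := fun w => h w fun u hu => (hne ⟨u, hu⟩).elim
      exact hne ⟨0, Classical.arbitrary A, fun α _ => h0 _⟩
    refine ⟨(↥U)ᵒᵈ, inferInstance, ⟨fun u v => ?_⟩, ⟨OrderDual.toDual ⟨_, hne.some_mem⟩⟩,
      fun u => (OrderDual.ofDual u).1, ⟨fun u v huv => huv, ?_, ?_⟩,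
      fun u => (OrderDual.ofDual u).2⟩
    · exact ⟨OrderDual.toDual ⟨_, hinf _ (OrderDual.ofDual u).2 _ (OrderDual.ofDual v).2⟩,
        (inf_le_left : (OrderDual.ofDual u).1 ⊓ (OrderDual.ofDual v).1 ≤ _),
        (inf_le_right : (OrderDual.ofDual u).1 ⊓ (OrderDual.ofDual v).1 ≤ _)⟩
    · rintro _ ⟨u, rfl⟩
      exact hU _ (OrderDual.ofDual u).2
    · intro w hw
      exact h w fun u hu => hw ⟨OrderDual.toDual ⟨u, hu⟩, rfl⟩

theorem OrderTendsto.of_decreasesToZero {A : Type w} [Preorder A] [IsDirectedOrder A]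
    [Nonempty A] {x : A → X} (hx : DecreasesToZero x) : OrderTendsto x 0 := by
  refine orderTendsto_iff.2 fun w hw => hx.2.2 ?_
  rintro _ ⟨α, rfl⟩
  refine hw _ ⟨α, fun β hβ => ?_⟩
  rw [sub_zero, abs_of_nonneg (hx.2.1 ⟨β, rfl⟩)]
  exact hx.1 hβ

theorem OrderTendsto.neg {A : Type w} [Preorder A] {x : A → X} {a : X}
    (hx : OrderTendsto x a) : OrderTendsto (fun α => -x α) (-a) := by
  obtain ⟨Λ, i₁, i₂, i₃, b, hb, h⟩ := hx
  refine ⟨Λ, i₁, i₂, i₃, b, hb, fun γ => ?_⟩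
  obtain ⟨α₀, hα⟩ := h γ
  refine ⟨α₀, fun α hα' => ?_⟩
  rw [neg_sub_neg, abs_sub_comm]
  exact hα α hα'

theorem orderTendsto_sub_iff {A : Type w} [Preorder A] {x : A → X} {a : X} :
    OrderTendsto (fun α => x α - a) 0 ↔ OrderTendsto x a := by
  simp only [OrderTendsto, sub_zero]

theorem IsArchimedean.le_of_forall_pos [Module ℝ X] [IsOrderedModule ℝ X]
    (hX : IsArchimedean X) {w p k : X} (h : ∀ ε : ℝ, 0 < ε → w ≤ p + ε • k) : w ≤ p := by
  have h1 : ∀ n : ℕ, (n + 1) • (w - p) ≤ k := fun n => by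
    have hn : (0 : ℝ) < n + 1 := by positivity
    have h2 := smul_le_smul_of_nonneg_left
      (sub_le_iff_le_add'.2 (h (n + 1 : ℝ)⁻¹ (by positivity))) hn.le
    rw [smul_smul, mul_inv_cancel₀ hn.ne', one_smul] at h2
    rw [← Nat.cast_smul_eq_nsmul ℝ]
    exact_mod_cast h2
  -- The sign of `k` is unknown, so one copy of `w - p` moves into the bound to cover `n = 0`.
  refine sub_nonpos.1 (hX _ (k - (w - p)) fun n => ?_)
  have := h1 n
  rw [succ_nsmul] at this
  exact le_sub_iff_add_le.2 this

theorem smul_le_of_le_inv_smul [Module ℝ X] [IsOrderedModule ℝ X] {w : X} {r : ℝ} (hr : 0 < r)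
    (h : r⁻¹ • w ≤ 0) : w ≤ 0 := by
  have := smul_le_smul_of_nonneg_left h hr.le
  rwa [smul_smul, mul_inv_cancel₀ hr.ne', one_smul, smul_zero] at this

end Convergence

/-! ### Order bounded operators and a substitute for the positive part. -/

section Operators

variable {E : Type u} {F : Type v}
  [AddCommGroup E] [Lattice E] [IsOrderedAddMonoid E] [Module ℝ E]
  [AddCommGroup F] [Lattice F] [IsOrderedAddMonoid F] [Module ℝ F]

theorem IsOrderContinuous.isSigmaOrderContinuous {T : E →ₗ[ℝ] F}
    (hT : IsOrderContinuous.{u, v, w} T) : IsSigmaOrderContinuous T := by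
  intro x hx
  have h : OrderTendsto (fun n : ULift.{w} ℕ => x n.down) 0 := by
    refine orderTendsto_iff.2 fun w hw => orderTendsto_iff.1 hx w fun u hu => hw u ?_
    obtain ⟨n, hn⟩ := hu
    exact ⟨⟨n⟩, fun m hm => hn m.down hm⟩
  refine orderTendsto_iff.2 fun w hw =>
    orderTendsto_iff.1 (hT (ULift.{w} ℕ) _ h) w fun u hu => hw u ?_
  obtain ⟨n, hn⟩ := hu
  exact ⟨n.down, fun m hm => hn ⟨m⟩ hm⟩

theorem IsOrderBounded.neg {T : E →ₗ[ℝ] F} (hT : IsOrderBounded T) : IsOrderBounded (-T) := by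
  intro s h1 h2
  obtain ⟨⟨a, ha⟩, ⟨b, hb⟩⟩ := hT s h1 h2
  refine ⟨⟨-b, ?_⟩, ⟨-a, ?_⟩⟩
  · rintro _ ⟨x, hx, rfl⟩
    exact neg_le_neg (hb ⟨x, hx, rfl⟩)
  · rintro _ ⟨x, hx, rfl⟩
    exact neg_le_neg (ha ⟨x, hx, rfl⟩)

theorem IsOrderBounded.bddAbove_image_Icc {T : E →ₗ[ℝ] F} (hT : IsOrderBounded T) (a b : E) :
    BddAbove (T '' Set.Icc a b) :=
  (hT _ bddBelow_Icc bddAbove_Icc).2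

/-- The upper bounds of the sets `T [0, b i]`, taken together, have no strictly positive lower
bound. In a Dedekind complete codomain this says that `T⁺ (b i)` has infimum `0`. -/
def NullAlong {ι : Type w} (T : E →ₗ[ℝ] F) (b : ι → E) : Prop :=
  ∀ w : F, (∀ i, ∀ u ∈ upperBounds (T '' Set.Icc 0 (b i)), w ≤ u) → w ≤ 0

/-- Both parts of `x α` eventually lie in `[0, b γ]` and in `[0, b δ]`, so `|T (x α)| ≤ u + v` for
upper bounds `u` of `T [0, b γ]` and `v` of `(-T) [0, b δ]`. -/
theorem orderTendsto_of_nullAlong {A : Type w} [Preorder A] [IsDirectedOrder A] [Nonempty A]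
    {Λ : Type*} [Preorder Λ] [IsDirectedOrder Λ] {T : E →ₗ[ℝ] F} {x : A → E} {b : Λ → E}
    (hb : Antitone b) (hx : ∀ γ, ∃ α₀ : A, ∀ α, α₀ ≤ α → |x α| ≤ b γ)
    (h₁ : NullAlong T b) (h₂ : NullAlong (-T) b) : OrderTendsto (fun α => T (x α)) 0 := by
  refine orderTendsto_iff.2 fun w hw => h₁ w fun γ u hu => ?_
  refine sub_nonpos.1 (h₂ _ fun δ v hv => ?_)
  rw [sub_le_iff_le_add']
  obtain ⟨η, hγ, hδ⟩ := exists_ge_ge γ δ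
  obtain ⟨α₀, hα⟩ := hx η
  refine hw _ ⟨α₀, fun α h => ?_⟩
  have hpos : (x α)⁺ ≤ b η := sup_le ((le_abs_self _).trans (hα α h))
    ((abs_nonneg _).trans (hα α h))
  have hneg : (x α)⁻ ≤ b η := sup_le ((neg_le_abs _).trans (hα α h))
    ((abs_nonneg _).trans (hα α h))
  have m₁ : (x α)⁺ ∈ Set.Icc 0 (b γ) := ⟨posPart_nonneg _, hpos.trans (hb hγ)⟩
  have m₂ : (x α)⁺ ∈ Set.Icc 0 (b δ) := ⟨posPart_nonneg _, hpos.trans (hb hδ)⟩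
  have m₃ : (x α)⁻ ∈ Set.Icc 0 (b γ) := ⟨negPart_nonneg _, hneg.trans (hb hγ)⟩
  have m₄ : (x α)⁻ ∈ Set.Icc 0 (b δ) := ⟨negPart_nonneg _, hneg.trans (hb hδ)⟩
  have hTx : T (x α) = T (x α)⁺ - T (x α)⁻ := by
    rw [← map_sub, posPart_sub_negPart]
  rw [sub_zero, hTx]
  refine sup_le ?_ ?_
  · rw [sub_eq_add_neg]
    exact add_le_add (hu ⟨_, m₁, rfl⟩) (hv ⟨_, m₄, rfl⟩)
  · rw [neg_sub, sub_eq_add_neg]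
    exact add_le_add (hu ⟨_, m₃, rfl⟩) (hv ⟨_, m₂, rfl⟩)

/-- The positive part of an order bounded operator vanishes along a decreasing sequence `b` as soon
as the operator sends all truncations `y ⊓ b n` to null sequences. -/
theorem nullAlong_of_sequence (hF : IsArchimedean F) {T : E →ₗ[ℝ] F} (hT : IsOrderBounded T)
    {b : ℕ → E} (hb : Antitone b) (h0 : ∀ n, 0 ≤ b n)
    (h : ∀ y, 0 ≤ y → y ≤ b 0 → OrderTendsto (fun n => T (y ⊓ b n)) 0) : NullAlong T b := by
  intro w hw
  obtain ⟨u₀, hu₀⟩ := hT.bddAbove_image_Icc 0 (b 0)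
  -- Subtracting `w` preserves upper bounds of `T [0, b 0]`; iteration gives `n • w ≤ u₀`.
  have step : ∀ u ∈ upperBounds (T '' Set.Icc 0 (b 0)),
      u - w ∈ upperBounds (T '' Set.Icc 0 (b 0)) := by
    rintro u hu _ ⟨y, ⟨hy0, hy⟩, rfl⟩
    have hsub : w - (u - T y) ≤ 0 := by
      refine orderTendsto_iff.1 (h y hy0 hy) _ ?_
      rintro v ⟨n, hn⟩
      have hv : T (y ⊓ b n) ≤ v := (le_abs_self _).trans (by simpa using hn n le_rfl)
      -- For `z ≤ b n` the element `z + (y - y ⊓ b n)` still lies in `[0, b 0]`, where `u` applies.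
      have key : u - T y + T (y ⊓ b n) ∈ upperBounds (T '' Set.Icc 0 (b n)) := by
        rintro _ ⟨z, ⟨hz0, hz⟩, rfl⟩
        have hle : z + (y - y ⊓ b n) ≤ b 0 := by
          have h1 : y - y ⊓ b n ≤ b 0 - b n := by
            have h2 : y - y ⊓ b n = (y ⊔ b n) - b n := by
              rw [sub_eq_sub_iff_add_eq_add, add_comm (y ⊔ b n), inf_add_sup]
            rw [h2]
            exact sub_le_sub_right (sup_le hy (hb (Nat.zero_le n))) _
          calc z + (y - y ⊓ b n) ≤ b n + (b 0 - b n) := add_le_add hz h1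
            _ = b 0 := by abel
        have := hu ⟨_, ⟨add_nonneg hz0 (sub_nonneg.2 inf_le_left), hle⟩, rfl⟩
        rw [map_add, map_sub] at this
        calc T z = T z + (T y - T (y ⊓ b n)) - T y + T (y ⊓ b n) := by abel
          _ ≤ u - T y + T (y ⊓ b n) := by gcongr
      rw [sub_le_iff_le_add']
      exact (hw n _ key).trans (by gcongr)
    have := sub_nonpos.1 hsub
    exact le_sub_comm.1 this
  have iter : ∀ n : ℕ, u₀ - n • w ∈ upperBounds (T '' Set.Icc 0 (b 0)) := by
    intro n
    induction n with
    | zero => simpa using hu₀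
    | succ n ih =>
      have := step _ ih
      rwa [sub_sub, ← succ_nsmul] at this
  refine hF w u₀ fun n => ?_
  have := iter n ⟨0, ⟨le_rfl, h0 0⟩, rfl⟩
  rwa [map_zero, sub_nonneg] at this

end Operators

/-! ### Spaces with countably many atoms. -/

section Atoms

variable {E : Type u} [AddCommGroup E] [Lattice E] [IsOrderedAddMonoid E]
  [Module ℝ E] [IsOrderedModule ℝ E]

/-- Each `b γ ⊓ e` is a multiple `r • e`; if always `r > ε`, then `ε • e` would be a positive lower
bound of the net. -/
theorem DecreasesToZero.exists_inf_atom_le {Λ : Type w} [Preorder Λ] [Nonempty Λ] {b : Λ → E}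
    (hb : DecreasesToZero b) {e : E} (he : IsRieszAtom e) (he0 : 0 < e) {ε : ℝ} (hε : 0 < ε) :
    ∃ γ, b γ ⊓ e ≤ ε • e := by
  by_contra hcon
  push Not at hcon
  have hle : ε • e ≤ 0 := by
    refine hb.2.2 ?_
    rintro _ ⟨γ, rfl⟩
    obtain ⟨r, hr⟩ := he.2 (b γ ⊓ e) (le_inf (hb.2.1 ⟨γ, rfl⟩) he.1) inf_le_right
    rcases le_total r ε with h | h
    · exact (hcon γ (hr ▸ smul_le_smul_of_nonneg_right h he.1)).elim
    · exact (smul_le_smul_of_nonneg_right h he.1).trans (hr ▸ inf_le_left)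
  have h1 := smul_le_smul_of_nonneg_left hle (inv_pos.2 hε).le
  rw [smul_smul, inv_mul_cancel₀ hε.ne', one_smul, smul_zero] at h1
  exact he0.not_ge h1

theorem exists_monotone_ge {Λ : Type w} [Preorder Λ] [IsDirectedOrder Λ] (g : ℕ → Λ) :
    ∃ m : ℕ → Λ, Monotone m ∧ ∀ n, g n ≤ m n := by
  choose s hs₁ hs₂ using fun a b : Λ => exists_ge_ge a b
  refine ⟨fun n => Nat.rec (g 0) (fun k a => s a (g (k + 1))) n,
    monotone_nat_of_le_succ fun n => hs₁ _ _, fun n => ?_⟩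
  cases n with
  | zero => exact le_rfl
  | succ n => exact hs₂ _ _

/-- In a space with a countable complete disjoint system of atoms, every net decreasing to `0`
has a subsequence decreasing to `0`. -/
theorem DecreasesToZero.exists_sequence (hE : IsArchimedean E) (hS : HasCountableAtomSystem E)
    {Λ : Type w} [Preorder Λ] [IsDirectedOrder Λ] [Nonempty Λ] {b : Λ → E}
    (hb : DecreasesToZero b) : ∃ m : ℕ → Λ, DecreasesToZero (b ∘ m) := by
  obtain ⟨S, hcount, ⟨hpos, -, hcomplete⟩, hatom⟩ := hS
  obtain ⟨f, hf⟩ := Set.countable_iff_exists_subset_range.1 hcount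
  -- Unpairing `n` runs through all pairs of an atom and a tolerance `1 / (k + 1)`.
  have hg : ∀ n : ℕ, ∃ γ, f n.unpair.1 ∈ S →
      b γ ⊓ f n.unpair.1 ≤ ((n.unpair.2 + 1 : ℝ))⁻¹ • f n.unpair.1 := by
    intro n
    by_cases h : f n.unpair.1 ∈ S
    · obtain ⟨γ, hγ⟩ := hb.exists_inf_atom_le (hatom _ h) (hpos _ h)
        (ε := ((n.unpair.2 + 1 : ℝ))⁻¹) (by positivity)
      exact ⟨γ, fun _ => hγ⟩
    · exact ⟨Classical.arbitrary Λ, fun h' => (h h').elim⟩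
  choose g hg using hg
  obtain ⟨m, hm, hgm⟩ := exists_monotone_ge g
  refine ⟨m, hb.1.comp_monotone hm, ?_, fun y hy => ?_⟩
  · rintro _ ⟨n, rfl⟩
    exact hb.2.1 ⟨m n, rfl⟩
  · have hy' : ∀ n, y⁺ ≤ b (m n) := fun n => sup_le (hy ⟨n, rfl⟩) (hb.2.1 ⟨m n, rfl⟩)
    refine (le_posPart y).trans (hcomplete _ fun e he => ?_).le
    refine le_antisymm ?_ (le_inf (posPart_nonneg _) (hpos e he).le)
    obtain ⟨i, rfl⟩ := hf he
    refine hE.le_of_forall_pos (k := f i) fun ε hε => ?_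
    obtain ⟨k, hk⟩ := exists_nat_one_div_lt hε
    have h1 := hg (Nat.pair i k)
    simp only [Nat.unpair_pair] at h1
    rw [zero_add]
    calc y⁺ ⊓ f i ≤ b (g (Nat.pair i k)) ⊓ f i :=
          inf_le_inf_right _ ((hy' _).trans (hb.1 (hgm _)))
      _ ≤ ((k : ℝ) + 1)⁻¹ • f i := h1 he
      _ ≤ ε • f i := smul_le_smul_of_nonneg_right (by rw [← one_div]; exact hk.le) (hpos _ he).le

variable {F : Type v} [AddCommGroup F] [Lattice F] [IsOrderedAddMonoid F] [Module ℝ F]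

theorem IsSigmaOrderContinuous.nullAlong (hF : IsArchimedean F) {T : E →ₗ[ℝ] F}
    (hT : IsOrderBounded T) (hσ : IsSigmaOrderContinuous T) {b : ℕ → E}
    (hb : DecreasesToZero b) : NullAlong T b := by
  refine nullAlong_of_sequence hF hT hb.1 (fun n => hb.2.1 ⟨n, rfl⟩) fun y hy0 _ =>
    hσ _ (OrderTendsto.of_decreasesToZero ⟨fun i j hij => inf_le_inf_left _ (hb.1 hij), ?_, ?_⟩)
  · rintro _ ⟨n, rfl⟩
    exact le_inf hy0 (hb.2.1 ⟨n, rfl⟩)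
  · intro w hw
    refine hb.2.2 ?_
    rintro _ ⟨n, rfl⟩
    exact (hw ⟨n, rfl⟩).trans inf_le_right

theorem IsSigmaOrderContinuous.neg {T : E →ₗ[ℝ] F} (hσ : IsSigmaOrderContinuous T) :
    IsSigmaOrderContinuous (-T) := fun x hx => by
  simpa using (hσ x hx).neg

theorem IsSigmaOrderContinuous.isOrderContinuous (hF : IsArchimedean F) (hE : IsArchimedean E)
    (hS : HasCountableAtomSystem E) {T : E →ₗ[ℝ] F}
    (hT : IsOrderBounded T) (hσ : IsSigmaOrderContinuous T) :
    IsOrderContinuous.{u, v, w} T := by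
  rintro A _ _ _ x ⟨Λ, _, _, _, b, hb, hx⟩
  obtain ⟨m, hm⟩ := hb.exists_sequence hE hS
  exact orderTendsto_of_nullAlong hm.1 (fun n => by simpa using hx (m n))
    (hσ.nullAlong hF hT hm) (hσ.neg.nullAlong hF hT.neg hm)

end Atoms

/-! ### Convergent and eventually constant sequences. -/

section Sequences

/-- `φ` represents `E` as a Riesz space of convergent sequences in which `e n` are the unit
sequences and `one` is the constant sequence `1`. -/
structure IsConvergentModel {E : Type u} [AddCommGroup E] [Lattice E] [Module ℝ E]
    (φ : E →ₗ[ℝ] (ℕ → ℝ)) (e : ℕ → E) (one : E) : Prop where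
  le_iff : ∀ x y, φ x ≤ φ y ↔ x ≤ y
  map_inf : ∀ x y, φ (x ⊓ y) = φ x ⊓ φ y
  convergent : ∀ x, ∃ a : ℝ, Tendsto (φ x) atTop (𝓝 a)
  map_e : ∀ n, φ (e n) = Pi.single n 1
  map_one : φ one = fun _ => 1

variable {E : Type u} {F : Type v}
  [AddCommGroup E] [Lattice E] [IsOrderedAddMonoid E] [Module ℝ E] [IsOrderedModule ℝ E]
  [AddCommGroup F] [Lattice F] [IsOrderedAddMonoid F] [Module ℝ F] [IsOrderedModule ℝ F]
  {φ : E →ₗ[ℝ] (ℕ → ℝ)} {e : ℕ → E} {one : E}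

theorem IsConvergentModel.map_tail (h : IsConvergentModel φ e one) (n i : ℕ) :
    φ (one - ∑ j ∈ Finset.range n, e j) i = if i < n then 0 else 1 := by
  rw [map_sub, map_sum, h.map_one, Pi.sub_apply, Finset.sum_apply]
  simp only [h.map_e, Pi.single_apply, Finset.sum_ite_eq, Finset.mem_range]
  split_ifs <;> simp

theorem IsConvergentModel.decreasesToZero_tail (h : IsConvergentModel φ e one) :
    DecreasesToZero fun n => one - ∑ j ∈ Finset.range n, e j := by
  refine ⟨fun m n hmn => (h.le_iff _ _).1 fun i => ?_, ?_, fun y hy => (h.le_iff _ _).1 fun i => ?_⟩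
  · rw [h.map_tail, h.map_tail]
    split_ifs
    · exact le_rfl
    · exact zero_le_one
    · omega
    · exact le_rfl
  · rintro _ ⟨n, rfl⟩
    refine (h.le_iff _ _).1 fun i => ?_
    rw [h.map_tail, map_zero]
    split_ifs <;> simp
  -- Tail `i + 1` is the first to vanish at coordinate `i`.
  · have := (h.le_iff _ _).2 (hy ⟨i + 1, rfl⟩) i
    rw [h.map_tail] at this
    simpa using this

/-- A coordinate `i` staying above `ε` would make `ε • e i` a lower bound of the net. -/
theorem IsConvergentModel.exists_le_of_decreasesToZero (h : IsConvergentModel φ e one)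
    {Λ : Type w} [Preorder Λ] [IsDirectedOrder Λ] [Nonempty Λ] {b : Λ → E}
    (hb : DecreasesToZero b) {ε : ℝ} (hε : 0 < ε) (γ₀ : Λ) (n : ℕ) :
    ∃ γ, γ₀ ≤ γ ∧ ∀ i < n, φ (b γ) i ≤ ε := by
  have hnonneg : ∀ γ i, 0 ≤ φ (b γ) i := fun γ i => by
    have := (h.le_iff _ _).2 (hb.2.1 ⟨γ, rfl⟩) i
    simpa using this
  have single : ∀ i, ∃ γ, φ (b γ) i ≤ ε := by
    intro i
    by_contra! hcon
    have : ε • e i ≤ 0 := by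
      refine hb.2.2 ?_
      rintro _ ⟨γ, rfl⟩
      refine (h.le_iff _ _).1 fun j => ?_
      rw [map_smul, Pi.smul_apply, h.map_e, Pi.single_apply]
      split_ifs with hj
      · rw [hj]
        simpa using (hcon γ).le
      · simpa using hnonneg γ j
    have := (h.le_iff _ _).2 this i
    rw [map_smul, Pi.smul_apply, h.map_e] at this
    simp only [Pi.single_eq_same, smul_eq_mul, mul_one, map_zero, Pi.zero_apply] at this
    exact hε.not_ge this
  induction n with
  | zero => exact ⟨γ₀, le_rfl, by simp⟩
  | succ n ih =>
    obtain ⟨γ, hγ, hn⟩ := ih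
    obtain ⟨δ, hδ⟩ := single n
    obtain ⟨η, h1, h2⟩ := exists_ge_ge γ δ
    refine ⟨η, hγ.trans h1, fun i hi => ?_⟩
    rcases Nat.lt_succ_iff_lt_or_eq.1 hi with hi | rfl
    · exact ((h.le_iff _ _).2 (hb.1 h1) i).trans (hn i hi)
    · exact ((h.le_iff _ _).2 (hb.1 h2) i).trans hδ

/-- If `y` has limit `a`, then `y ⊓ t n - a • t n` tends to `0` uniformly, so order boundedness
reduces `T (y ⊓ t n)` to `a • T (t n)`. -/
theorem IsConvergentModel.nullAlong_tail (h : IsConvergentModel φ e one) (hF : IsArchimedean F)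
    {T : E →ₗ[ℝ] F} (hT : IsOrderBounded T)
    (hone : OrderTendsto (fun n => T (one - ∑ j ∈ Finset.range n, e j)) 0) :
    NullAlong T fun n => one - ∑ j ∈ Finset.range n, e j := by
  refine nullAlong_of_sequence hF hT h.decreasesToZero_tail.1
    (fun n => h.decreasesToZero_tail.2.1 ⟨n, rfl⟩) fun y hy0 hy => ?_
  simp only [Finset.range_zero, Finset.sum_empty, sub_zero] at hy
  set t : ℕ → E := fun n => one - ∑ j ∈ Finset.range n, e j with ht
  have hy0' : ∀ i, 0 ≤ φ y i := fun i => by simpa using (h.le_iff _ _).2 hy0 i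
  have hy1' : ∀ i, φ y i ≤ 1 := fun i => by simpa [h.map_one] using (h.le_iff _ _).2 hy i
  obtain ⟨a, ha⟩ := h.convergent y
  have ha0 : 0 ≤ a := ge_of_tendsto' ha hy0'
  have ha1 : a ≤ 1 := le_of_tendsto' ha hy1'
  obtain ⟨k, hk⟩ := hT.bddAbove_image_Icc (-one) one
  refine orderTendsto_iff.2 fun w hw => orderTendsto_iff.1 hone w ?_
  rintro u ⟨n₀, hn₀⟩
  refine hF.le_of_forall_pos (k := k) fun δ hδ => hw _ ?_
  obtain ⟨n₁, hn₁⟩ := Metric.tendsto_atTop.1 ha δ hδ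
  refine ⟨max n₀ n₁, fun n hn => ?_⟩
  have hdiff : ∀ i, |φ (y ⊓ t n - a • t n) i| ≤ δ := fun i => by
    rw [map_sub, h.map_inf, map_smul, Pi.sub_apply, Pi.inf_apply, Pi.smul_apply, h.map_tail]
    split_ifs with hi
    · simp [hy0' i, hδ.le]
    · have := hn₁ i (((le_max_right _ _).trans hn).trans (not_lt.1 hi))
      rw [Real.dist_eq] at this
      rw [inf_eq_left.2 (hy1' i), smul_eq_mul, mul_one]
      exact this.le
  -- The rescaled error lies in `[-one, one]`, where `T` is bounded by `k` independently of `δ` and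
  -- `n`.
  obtain ⟨d, hd⟩ : ∃ d, d = δ⁻¹ • (y ⊓ t n - a • t n) := ⟨_, rfl⟩
  have hdi : ∀ i, |φ d i| ≤ 1 := fun i => by
    rw [hd, map_smul, Pi.smul_apply, smul_eq_mul, abs_mul, abs_of_pos (inv_pos.2 hδ)]
    calc _ ≤ δ⁻¹ * δ := by gcongr; exact hdiff i
      _ = 1 := inv_mul_cancel₀ hδ.ne'
  have hd1 : d ≤ one := (h.le_iff _ _).1 fun i => by
    rw [h.map_one]; exact (abs_le.1 (hdi i)).2
  have hd2 : -one ≤ d := (h.le_iff _ _).1 fun i => by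
    rw [map_neg, h.map_one]; exact (abs_le.1 (hdi i)).1
  have hTd : T d ≤ k := hk ⟨d, ⟨hd2, hd1⟩, rfl⟩
  have hTd' : -T d ≤ k := by
    rw [← map_neg]
    exact hk ⟨-d, ⟨neg_le_neg hd1, neg_le.1 hd2⟩, rfl⟩
  have hu : |T (t n)| ≤ u := by
    rw [← sub_zero (T (t n))]
    exact hn₀ n ((le_max_left _ _).trans hn)
  have hu0 : 0 ≤ u := (abs_nonneg _).trans hu
  have hau : a • u ≤ u := by
    simpa using smul_le_smul_of_nonneg_right ha1 hu0
  have hT' : T (y ⊓ t n) = a • T (t n) + δ • T d := by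
    rw [hd, ← map_smul, ← map_smul, ← map_add, smul_smul, mul_inv_cancel₀ hδ.ne', one_smul]
    congr 1
    abel
  rw [sub_zero, hT']
  refine sup_le ?_ ?_
  · exact add_le_add ((smul_le_smul_of_nonneg_left ((le_abs_self _).trans hu) ha0).trans hau)
      (smul_le_smul_of_nonneg_left hTd hδ.le)
  · rw [neg_add, ← smul_neg, ← smul_neg]
    exact add_le_add ((smul_le_smul_of_nonneg_left ((neg_le_abs _).trans hu) ha0).trans hau)
      (smul_le_smul_of_nonneg_left hTd' hδ.le)

/-- Once `b γ ≤ ε` on the first `n` coordinates, any `z` in `[0, b γ]` splits into `z ⊓ ε • one` and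
a remainder below `M` times the `n`-th tail, whence `T z ≤ M • v + ε • k`. -/
theorem IsConvergentModel.nullAlong (h : IsConvergentModel φ e one) (hF : IsArchimedean F)
    {T : E →ₗ[ℝ] F} (hT : IsOrderBounded T)
    (hone : OrderTendsto (fun n => T (one - ∑ j ∈ Finset.range n, e j)) 0)
    {Λ : Type w} [Preorder Λ] [IsDirectedOrder Λ] [Nonempty Λ] {b : Λ → E}
    (hb : DecreasesToZero b) : NullAlong T b := by
  intro w hw
  let γ₀ : Λ := Classical.arbitrary Λ
  obtain ⟨M, hM0, hM⟩ : ∃ M : ℝ, 0 < M ∧ ∀ i, φ (b γ₀) i ≤ M := by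
    obtain ⟨a, ha⟩ := h.convergent (b γ₀)
    obtain ⟨M, hM⟩ := ha.bddAbove_range
    exact ⟨max M 1, lt_max_of_lt_right one_pos, fun i => (hM ⟨i, rfl⟩).trans (le_max_left _ _)⟩
  obtain ⟨k, hk⟩ := hT.bddAbove_image_Icc 0 one
  refine smul_le_of_le_inv_smul hM0 (h.nullAlong_tail hF hT hone _ fun n v hv => ?_)
  suffices hwM : w ≤ M • v by
    have := smul_le_smul_of_nonneg_left hwM (inv_pos.2 hM0).le
    rwa [smul_smul, inv_mul_cancel₀ hM0.ne', one_smul] at this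
  refine hF.le_of_forall_pos (k := k) fun ε hε => ?_
  obtain ⟨γ, hγ, hγε⟩ := h.exists_le_of_decreasesToZero hb hε γ₀ n
  refine hw γ _ ?_
  rintro _ ⟨z, ⟨hz0, hz⟩, rfl⟩
  have hz0' : ∀ i, 0 ≤ φ z i := fun i => by simpa using (h.le_iff _ _).2 hz0 i
  have hz' : ∀ i, φ z i ≤ φ (b γ) i := (h.le_iff _ _).2 hz
  have hzM : ∀ i, φ z i ≤ M := fun i =>
    (hz' i).trans (((h.le_iff _ _).2 (hb.1 hγ) i).trans (hM i))
  have hmin : ∀ i, φ (z ⊓ ε • one) i = min (φ z i) ε := fun i => by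
    rw [h.map_inf, map_smul, h.map_one, Pi.inf_apply, Pi.smul_apply, smul_eq_mul, mul_one]
  have hp : ε⁻¹ • (z ⊓ ε • one) ∈ Set.Icc 0 one := by
    constructor
    · refine (h.le_iff _ _).1 fun i => ?_
      rw [map_zero, map_smul, Pi.smul_apply, hmin, smul_eq_mul]
      exact mul_nonneg (inv_pos.2 hε).le (le_min (hz0' i) hε.le)
    · refine (h.le_iff _ _).1 fun i => ?_
      rw [h.map_one, map_smul, Pi.smul_apply, hmin, smul_eq_mul]
      calc _ ≤ ε⁻¹ * ε := by gcongr; exact min_le_right _ _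
        _ = 1 := inv_mul_cancel₀ hε.ne'
  have hq : M⁻¹ • (z - z ⊓ ε • one) ∈ Set.Icc 0 (one - ∑ j ∈ Finset.range n, e j) := by
    constructor
    · refine (h.le_iff _ _).1 fun i => ?_
      rw [map_zero, map_smul, map_sub, Pi.smul_apply, Pi.sub_apply, hmin, smul_eq_mul]
      exact mul_nonneg (inv_pos.2 hM0).le (sub_nonneg.2 (min_le_left _ _))
    · refine (h.le_iff _ _).1 fun i => ?_
      rw [h.map_tail, map_smul, map_sub, Pi.smul_apply, Pi.sub_apply, hmin, smul_eq_mul]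
      split_ifs with hi
      · rw [min_eq_left ((hz' i).trans (hγε i hi)), sub_self, mul_zero]
      · calc _ ≤ M⁻¹ * M := by
              gcongr
              exact (sub_le_self _ (le_min (hz0' i) hε.le)).trans (hzM i)
          _ = 1 := inv_mul_cancel₀ hM0.ne'
  have h1 := smul_le_smul_of_nonneg_left (hk ⟨_, hp, rfl⟩) hε.le
  have h2 := smul_le_smul_of_nonneg_left (hv ⟨_, hq, rfl⟩) hM0.le
  rw [map_smul, smul_smul, mul_inv_cancel₀ hε.ne', one_smul] at h1
  rw [map_smul, smul_smul, mul_inv_cancel₀ hM0.ne', one_smul] at h2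
  calc T z = T (z - z ⊓ ε • one) + T (z ⊓ ε • one) := by rw [← map_add, sub_add_cancel]
    _ ≤ M • v + ε • k := add_le_add h2 h1

theorem IsConvergentModel.isOrderContinuous_iff (h : IsConvergentModel φ e one)
    (hF : IsArchimedean F) {T : E →ₗ[ℝ] F} (hT : IsOrderBounded T) :
    IsOrderContinuous.{u, v, w} T ↔
      OrderTendsto (fun n : ℕ => ∑ i ∈ Finset.range n, T (e i)) (T one) := by
  -- Partial sum minus limit is `-T` of the tail, hence the sign.
  have hiff : OrderTendsto (fun n : ℕ => ∑ i ∈ Finset.range n, T (e i)) (T one) ↔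
      OrderTendsto (fun n => (-T) (one - ∑ j ∈ Finset.range n, e j)) 0 := by
    rw [← orderTendsto_sub_iff]
    simp
  rw [hiff]
  constructor
  · intro hc
    have := (hc.isSigmaOrderContinuous _
      (OrderTendsto.of_decreasesToZero h.decreasesToZero_tail)).neg
    simpa using this
  · rintro hone A _ _ _ x ⟨Λ, _, _, _, b, hb, hx⟩
    have hone' : OrderTendsto (fun n => T (one - ∑ j ∈ Finset.range n, e j)) 0 := by
      simpa using hone.neg
    exact orderTendsto_of_nullAlong hb.1 (by simpa using hx) (h.nullAlong hF hT hone' hb)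
      (h.nullAlong hF hT.neg hone hb)

theorem isConvergentModel_convSeq :
    IsConvergentModel ConvSeq.subtype ConvSeq.e ConvSeq.one where
  le_iff _ _ := Iff.rfl
  map_inf _ _ := rfl
  convergent x := x.2
  map_e _ := rfl
  map_one := rfl

theorem isConvergentModel_evConstSeq :
    IsConvergentModel EvConstSeq.subtype EvConstSeq.e EvConstSeq.one where
  le_iff _ _ := Iff.rfl
  map_inf _ _ := rfl
  convergent x := by
    obtain ⟨a, ha⟩ := x.2
    exact ⟨a, tendsto_const_nhds.congr' (ha.mono fun _ h => h.symm)⟩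
  map_e _ := rfl
  map_one := rfl

end Sequences

end RieszOC

theorem theorem4p1 {F : Type v} [AddCommGroup F] [Lattice F] [IsOrderedAddMonoid F]
    [Module ℝ F] [IsOrderedModule ℝ F] (hF : RieszOC.IsArchimedean F) :
    (∀ (E : Type u) [AddCommGroup E] [Lattice E] [IsOrderedAddMonoid E]
        [Module ℝ E] [IsOrderedModule ℝ E],
      RieszOC.IsArchimedean E → RieszOC.HasCountableAtomSystem E →
      ∀ T : E →ₗ[ℝ] F, RieszOC.IsOrderBounded T →
        (RieszOC.IsOrderContinuous.{u, v, w} T ↔ RieszOC.IsSigmaOrderContinuous T)) ∧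
    (∀ T : RieszOC.ConvSeq →ₗ[ℝ] F, RieszOC.IsOrderBounded T →
      (RieszOC.IsOrderContinuous.{0, v, w} T ↔
        RieszOC.OrderTendsto (fun n : ℕ => ∑ i ∈ Finset.range n, T (RieszOC.ConvSeq.e i))
          (T RieszOC.ConvSeq.one))) ∧
    (∀ T : RieszOC.EvConstSeq →ₗ[ℝ] F, RieszOC.IsOrderBounded T →
      (RieszOC.IsOrderContinuous.{0, v, w} T ↔
        RieszOC.OrderTendsto (fun n : ℕ => ∑ i ∈ Finset.range n, T (RieszOC.EvConstSeq.e i))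
          (T RieszOC.EvConstSeq.one))) := by
  refine ⟨fun E _ _ _ _ _ hE hS T hT => ⟨fun h => h.isSigmaOrderContinuous,
    fun h => h.isOrderContinuous hF hE hS hT⟩,
    fun T hT => RieszOC.isConvergentModel_convSeq.isOrderContinuous_iff hF hT,
    fun T hT => RieszOC.isConvergentModel_evConstSeq.isOrderContinuous_iff hF hT⟩
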